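/- Let $G$ be a finitely generated group that is nilpotent of class exactly $2$ and has prime exponent $p$. Then $G/Z(G)$ and $[G,G]$ are abelian groups of exponent dividing $p$, and we regard them as vector spaces over $\mathbb{F}_p$. Write $[x,y]=x^{-1}y^{-1}xy$. Let $x_1,\ldots,x_k\in G$ be elements whose images in $G/Z(G)$ form a basis of the vector space $G/Z(G)$, and suppose that the nontrivial commutators among $[x_j,x_i]$, $1\leq i<j\leq k$, are pairwise distinct and form a basis of the vector space $[G,G]$. Then $G$ is capable; that is, there exists a group $H$ such that $G\cong H/Z(H)$. -/

import Mathlib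

/-- A group `G` is capable if it is isomorphic to `H ⧸ Z(H)` for some group `H`. -/
def IsCapable.{u} (G : Type u) [Group G] : Prop :=
  ∃ (H : Type u) (_ : Group H), Nonempty (G ≃* H ⧸ Subgroup.center H)

/-- The commutator `[x, y] = x⁻¹ y⁻¹ x y`. -/
def groupComm {G : Type*} [Group G] (x y : G) : G := x⁻¹ * y⁻¹ * x * y

theorem groupComm_mem {G : Type*} [Group G] (x y : G) : groupComm x y ∈ commutator G := by
  have h := Subgroup.commutator_mem_commutator (Subgroup.mem_top x⁻¹) (Subgroup.mem_top y⁻¹)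
  simpa [commutator_def, groupComm, commutatorElement_def] using h

/-- The commutative group structure on a group `A` all of whose elements commute. -/
abbrev commGroupOfComm {A : Type*} [Group A] (hc : ∀ a b : A, a * b = b * a) : CommGroup A :=
  { (inferInstance : Group A) with mul_comm := hc }

/-- The `ZMod p`-module structure on `A`, written additively, for a commutative group `A` with
`a ^ p = 1` for all `a`. -/
abbrev elementaryAbelianModule (p : ℕ) (A : Type*) [CommGroup A] (he : ∀ a : A, a ^ p = 1) :
    Module (ZMod p) (Additive A) :=
  AddCommGroup.zmodModule (n := p) (G := Additive A) (fun a => he a.toMul)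

/-- The family `v` of elements of the `R`-module `M` is a basis of `M`. -/
def IsModuleBasis (R M : Type*) [Semiring R] [AddCommMonoid M] [Module R M]
    {ι : Type*} (v : ι → M) : Prop :=
  LinearIndependent R v ∧ Submodule.span R (Set.range v) = ⊤

/-- For a group `A` that is commutative (`hc`) and satisfies `a ^ p = 1` for all `a` (`he`),
the family `b` is a basis of `A` as a vector space over `ZMod p` (the vector space being `A`
written additively). A basis being an indexed family, its members are in particular pairwise
distinct when `p` is prime. -/
def IsElementaryAbelianBasis (p : ℕ) {A : Type*} [Group A]
    (hc : ∀ a b : A, a * b = b * a) (he : ∀ a : A, a ^ p = 1)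
    {ι : Type*} (b : ι → A) : Prop :=
  letI : CommGroup A := commGroupOfComm hc
  letI : Module (ZMod p) (Additive A) := elementaryAbelianModule p A he
  IsModuleBasis (ZMod p) (Additive A) (fun i => Additive.ofMul (b i))

theorem commutator_le_center_of_class_two {G : Type*} [Group G] [Group.IsNilpotent G]
    (h : Group.nilpotencyClass G = 2) : commutator G ≤ Subgroup.center G := by
  have h2 : Subgroup.lowerCentralSeries (⊤ : Subgroup G) 2 = ⊥ := by
    rw [← h]; exact Subgroup.lowerCentralSeries_nilpotencyClass
  rw [Subgroup.lowerCentralSeries_succ, Subgroup.top_lowerCentralSeries_one,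
    Subgroup.commutator_eq_bot_iff_le_centralizer, Subgroup.coe_top,
    Subgroup.centralizer_univ] at h2
  exact h2

theorem centralQuotient_mul_comm {G : Type*} [Group G] [Group.IsNilpotent G]
    (h : Group.nilpotencyClass G = 2) (a b : G ⧸ Subgroup.center G) : a * b = b * a := by
  induction a using QuotientGroup.induction_on with | H a => ?_
  induction b using QuotientGroup.induction_on with | H b => ?_
  rw [← QuotientGroup.mk_mul, ← QuotientGroup.mk_mul, QuotientGroup.eq]
  apply commutator_le_center_of_class_two h
  have := groupComm_mem b a
  simpa [groupComm, mul_assoc] using this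

theorem centralQuotient_pow {G : Type*} [Group G] {p : ℕ} (h : Monoid.exponent G = p)
    (a : G ⧸ Subgroup.center G) : a ^ p = 1 := by
  induction a using QuotientGroup.induction_on with | H a => ?_
  rw [← QuotientGroup.mk_pow, ← h, Monoid.pow_exponent_eq_one, QuotientGroup.mk_one]

theorem commutator_mul_comm {G : Type*} [Group G] [Group.IsNilpotent G]
    (h : Group.nilpotencyClass G = 2) (a b : commutator G) : a * b = b * a := by
  have := Subgroup.mem_center_iff.1 (commutator_le_center_of_class_two h a.2) b
  exact Subtype.ext this.symm

theorem commutator_pow {G : Type*} [Group G] {p : ℕ} (h : Monoid.exponent G = p)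
    (a : commutator G) : a ^ p = 1 :=
  Subtype.ext (by rw [Subgroup.coe_pow, ← h, Monoid.pow_exponent_eq_one, Subgroup.coe_one])

/-! It suffices to give, for each central `g ≠ 1`, a cocycle `f` with values in `ZMod p` and a `y`
with `f(g,y) ≠ f(y,g)`: in the extension by all cocycles at once, the centre is then exactly the
kernel.

If `g ∉ [G,G]`, take `f(a,b) = φ(a)ψ(b)` with `φ(g) ≠ 0`, `ψ` trivial on `Z(G)` and `ψ(y) ≠ 0`.

If `g ∈ [G,G]`, some coordinate `l` of `g`, dual to a basis commutator `[x_j,x_i]`, is nonzero.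
Since all other `[x_n,x_m]` with `m < n` are trivial or different basis vectors, `l([a,b])` is the
form `α ∧ β`, with `α`, `β` the `j`-th and `i`-th coordinates. So `G` has a Heisenberg-type
quotient: there is `γ` with `γ(ab) = γ(a) + γ(b) + uα(a)β(b)`, `u ≠ 0`, and `γ = ul` on `[G,G]`. As
`p` is odd, `α(a)γ(b) + u·C(α(a),2)β(b)` is a cocycle, and it separates `g` from `x_j`. -/

/-! ### Central extensions and capability. -/

/-- A normalized `2`-cocycle on `G` with values in the trivial module `A`. -/
structure NormalizedCocycle (G A : Type*) [Group G] [AddCommGroup A] where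
  /-- The underlying function. -/
  toFun : G → G → A
  one_left : ∀ g, toFun 1 g = 0
  one_right : ∀ g, toFun g 1 = 0
  cocycle : ∀ a b c, toFun a b + toFun (a * b) c = toFun b c + toFun a (b * c)

/-- The central extension of `G` by `A` determined by a normalized `2`-cocycle. -/
@[ext]
structure CentralExtension {G A : Type*} [Group G] [AddCommGroup A]
    (f : NormalizedCocycle G A) where
  /-- The component in `G`. -/
  base : G
  /-- The component in `A`. -/
  fiber : A

namespace CentralExtension

variable {G A : Type*} [Group G] [AddCommGroup A] {f : NormalizedCocycle G A}

instance : Mul (CentralExtension f) :=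
  ⟨fun x y => ⟨x.base * y.base, x.fiber + y.fiber + f.toFun x.base y.base⟩⟩

instance : One (CentralExtension f) := ⟨⟨1, 0⟩⟩

instance : Inv (CentralExtension f) :=
  ⟨fun x => ⟨x.base⁻¹, -x.fiber - f.toFun x.base⁻¹ x.base⟩⟩

@[simp] theorem mul_base (x y : CentralExtension f) : (x * y).base = x.base * y.base := rfl

@[simp] theorem mul_fiber (x y : CentralExtension f) :
    (x * y).fiber = x.fiber + y.fiber + f.toFun x.base y.base := rfl

@[simp] theorem one_base : (1 : CentralExtension f).base = 1 := rfl

@[simp] theorem one_fiber : (1 : CentralExtension f).fiber = 0 := rfl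

@[simp] theorem inv_base (x : CentralExtension f) : x⁻¹.base = x.base⁻¹ := rfl

@[simp] theorem inv_fiber (x : CentralExtension f) :
    x⁻¹.fiber = -x.fiber - f.toFun x.base⁻¹ x.base := rfl

instance : Group (CentralExtension f) :=
  Group.ofLeftAxioms
    (fun x y z => by
      ext
      · simp [mul_assoc]
      · have := f.cocycle x.base y.base z.base
        simp only [mul_fiber, mul_base]
        rw [← sub_eq_zero] at this ⊢
        rw [← this]
        abel)
    (fun x => by ext <;> simp [f.one_left])
    (fun x => by
      ext
      · simp
      · simp only [mul_fiber, inv_fiber, inv_base, one_fiber]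
        abel)

/-- The projection of a central extension onto its base. -/
def proj (f : NormalizedCocycle G A) : CentralExtension f →* G where
  toFun := base
  map_one' := rfl
  map_mul' _ _ := rfl

theorem proj_surjective (f : NormalizedCocycle G A) : Function.Surjective (proj f) :=
  fun g => ⟨⟨g, 0⟩, rfl⟩

theorem mem_center_iff (x : CentralExtension f) :
    x ∈ Subgroup.center (CentralExtension f) ↔
      x.base ∈ Subgroup.center G ∧ ∀ h, f.toFun x.base h = f.toFun h x.base := by
  simp only [Subgroup.mem_center_iff]
  constructor
  · intro h
    refine ⟨fun g => congrArg base (h ⟨g, 0⟩), fun g => ?_⟩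
    have := congrArg fiber (h ⟨g, 0⟩)
    simp only [mul_fiber, zero_add, add_zero] at this
    exact (add_left_cancel this).symm
  · rintro ⟨h₁, h₂⟩ y
    ext
    · exact h₁ y.base
    · simp [h₂, add_comm]

end CentralExtension

/-- A group is capable if every nontrivial central element is moved out of the centre by some
central extension with kernel `A`. -/
theorem isCapable_of_cocycles.{u} {G : Type u} {A : Type} [Group G] [AddCommGroup A]
    (h : ∀ g ∈ Subgroup.center G, g ≠ 1 →
      ∃ (f : NormalizedCocycle G A) (y : G), f.toFun g y ≠ f.toFun y g) : IsCapable G := by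
  -- All cocycles bundled into one: `F` is symmetric at a pair only if every `f` is.
  let F : NormalizedCocycle G (NormalizedCocycle G A → A) :=
    { toFun := fun a b f => f.toFun a b
      one_left := fun g => funext fun f => f.one_left g
      one_right := fun g => funext fun f => f.one_right g
      cocycle := fun a b c => funext fun f => f.cocycle a b c }
  have hker : (CentralExtension.proj F).ker = Subgroup.center (CentralExtension F) := by
    ext x
    rw [CentralExtension.mem_center_iff, MonoidHom.mem_ker]
    change x.base = 1 ↔ _
    constructor
    · intro hx
      rw [hx]
      exact ⟨one_mem _, fun y => by rw [F.one_left, F.one_right]⟩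
    · rintro ⟨hc, hF⟩
      by_contra hne
      obtain ⟨f, y, hy⟩ := h _ hc hne
      exact hy (congrFun (hF y) f)
  exact ⟨CentralExtension F, inferInstance,
    ⟨((QuotientGroup.quotientMulEquivOfEq hker.symm).trans
      (QuotientGroup.quotientKerEquivOfSurjective _
        (CentralExtension.proj_surjective F))).symm⟩⟩

/-! ### Detecting elements by homomorphisms to `ZMod p`. -/

theorem exists_addMonoidHom_zmod_ne_zero {p : ℕ} [Fact p.Prime] {V : Type*} [AddCommGroup V]
    [Module (ZMod p) V] {v : V} (hv : v ≠ 0) : ∃ l : V →+ ZMod p, l v ≠ 0 := by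
  let B := Module.Basis.ofVectorSpace (ZMod p) V
  by_contra! h
  exact hv (B.forall_coord_eq_zero_iff.1 fun i => h (B.coord i).toAddMonoidHom)

/-- The nontrivial elements of an elementary abelian group are detected by homomorphisms to
`ZMod p`. -/
theorem exists_hom_zmod_apply_ne_one {A : Type*} [CommGroup A] {p : ℕ} [Fact p.Prime]
    (he : ∀ a : A, a ^ p = 1) {a : A} (ha : a ≠ 1) :
    ∃ φ : A →* Multiplicative (ZMod p), φ a ≠ 1 := by
  let _ : Module (ZMod p) (Additive A) := elementaryAbelianModule p A he
  have hne : Additive.ofMul a ≠ 0 := ha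
  obtain ⟨l, hl⟩ := exists_addMonoidHom_zmod_ne_zero (p := p) hne
  exact ⟨AddMonoidHom.toMultiplicativeRight l, hl⟩

/-- An element outside a normal subgroup with elementary abelian quotient is detected by a
homomorphism to `ZMod p` vanishing on that subgroup. -/
theorem exists_hom_zmod_ne_one {G : Type*} [Group G] {p : ℕ} [Fact p.Prime] (N : Subgroup G)
    [N.Normal] (hc : ∀ a b : G, a⁻¹ * b⁻¹ * a * b ∈ N) (he : ∀ a : G, a ^ p ∈ N)
    {g : G} (hg : g ∉ N) :
    ∃ φ : G →* Multiplicative (ZMod p), (∀ n ∈ N, φ n = 1) ∧ φ g ≠ 1 := by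
  have hcQ : ∀ a b : G ⧸ N, a * b = b * a := by
    intro a b
    induction a using QuotientGroup.induction_on with | H a => ?_
    induction b using QuotientGroup.induction_on with | H b => ?_
    rw [← QuotientGroup.mk_mul, ← QuotientGroup.mk_mul, QuotientGroup.eq]
    simpa [mul_assoc] using hc b a
  have heQ : ∀ a : G ⧸ N, a ^ p = 1 := by
    intro a
    induction a using QuotientGroup.induction_on with | H a => ?_
    rw [← QuotientGroup.mk_pow]
    exact (QuotientGroup.eq_one_iff _).2 (he a)
  obtain ⟨φ, hφ⟩ := @exists_hom_zmod_apply_ne_one _ (commGroupOfComm hcQ) p _ heQ (g : G ⧸ N)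
    fun h => hg ((QuotientGroup.eq_one_iff _).1 h)
  refine ⟨φ.comp (QuotientGroup.mk' N), fun n hn => ?_, hφ⟩
  rw [MonoidHom.comp_apply, QuotientGroup.mk'_apply, (QuotientGroup.eq_one_iff n).2 hn, map_one]

/-! ### Commutators in class two and the cocycles. -/

section ClassTwo

variable {G : Type*} [Group G]

theorem groupComm_mul_left (h : commutator G ≤ Subgroup.center G) (a b c : G) :
    groupComm (a * b) c = groupComm a c * groupComm b c := by
  have := Subgroup.mem_center_iff.1 (h (groupComm_mem a c)) b
  calc groupComm (a * b) c = b⁻¹ * groupComm a c * (c⁻¹ * b * c) := by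
        simp only [groupComm]; group
    _ = b⁻¹ * (b * groupComm a c) * b⁻¹ * (c⁻¹ * b * c) := by rw [this]; group
    _ = _ := by simp only [groupComm]; group

theorem groupComm_inv (a b : G) : (groupComm a b)⁻¹ = groupComm b a := by
  simp [groupComm, mul_assoc]

theorem groupComm_mul_right (h : commutator G ≤ Subgroup.center G) (a b c : G) :
    groupComm a (b * c) = groupComm a b * groupComm a c := by
  rw [← groupComm_inv, groupComm_mul_left h, mul_inv_rev, groupComm_inv, groupComm_inv]
  exact Subgroup.mem_center_iff.1 (h (groupComm_mem a b)) _

theorem groupComm_eq_one_of_mem_center {a : G} (ha : a ∈ Subgroup.center G) (b : G) :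
    groupComm a b = 1 := by
  have := Subgroup.mem_center_iff.1 ha b
  simp only [groupComm, mul_assoc]
  rw [← this]
  group

/-- A functional on the commutator subgroup whose composition with the commutator is the
alternating form `α ∧ β` yields a function `γ` with coboundary a multiple of `α ⊗ β`. -/
theorem exists_quasi_hom {p : ℕ} [Fact p.Prime] (hp2 : p ≠ 2) (hexp : ∀ g : G, g ^ p = 1)
    (hcen : commutator G ≤ Subgroup.center G)
    (α β : G →* Multiplicative (ZMod p)) (l : commutator G →* Multiplicative (ZMod p))
    (hα : ∀ g ∈ Subgroup.center G, α g = 1) (hβ : ∀ g ∈ Subgroup.center G, β g = 1)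
    (hl : ∀ g h : G, (l ⟨groupComm g h, groupComm_mem g h⟩).toAdd =
      (α g).toAdd * (β h).toAdd - (β g).toAdd * (α h).toAdd) :
    ∃ (γ : G → ZMod p) (u : ZMod p), u ≠ 0 ∧
      (∀ g h, γ (g * h) = γ g + γ h + u * ((α g).toAdd * (β h).toAdd)) ∧
      ∀ w : commutator G, γ w = u * (l w).toAdd := by
  have h2 : (2 : ZMod p) ≠ 0 := by
    have := (Fact.out : p.Prime)
    intro h
    have h' : ((2 : ℕ) : ZMod p) = 0 := by exact_mod_cast h
    rw [ZMod.natCast_eq_zero_iff] at h'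
    exact hp2 ((Nat.prime_dvd_prime_iff_eq this Nat.prime_two).1 h')
  -- The sign makes commutators in the extension equal `([a,b], -l([a,b]))`, so they lie in `D`, the
  -- graph of `-l`. A character `χ` killing `D` but not `(1,1)` then gives `γ(g) = χ(g,0)` and `u =
  -- χ(1,1)`.
  let f : NormalizedCocycle G (ZMod p) :=
    { toFun := fun g h => -((α g).toAdd * (β h).toAdd)
      one_left := by simp
      one_right := by simp
      cocycle := fun a b c => by simp only [map_mul, toAdd_mul]; ring }
  have hf : ∀ g h, f.toFun g h = -((α g).toAdd * (β h).toAdd) := fun _ _ => rfl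
  have hαc : ∀ w : commutator G, α w = 1 := fun w => hα _ (hcen w.2)
  have hβc : ∀ w : commutator G, β w = 1 := fun w => hβ _ (hcen w.2)
  let D : Subgroup (CentralExtension f) :=
    { carrier := {x | ∃ w : commutator G, x = ⟨w, -(l w).toAdd⟩}
      one_mem' := ⟨1, by ext <;> simp⟩
      mul_mem' := by
        rintro _ _ ⟨v, rfl⟩ ⟨w, rfl⟩
        refine ⟨v * w, ?_⟩
        ext
        · simp
        · simp only [CentralExtension.mul_fiber, hf, hαc, map_mul, toAdd_mul, toAdd_one]
          ring
      inv_mem' := by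
        rintro _ ⟨w, rfl⟩
        refine ⟨w⁻¹, ?_⟩
        ext
        · simp
        · simp [hf, hαc, hβc] }
  have hDcen : D ≤ Subgroup.center _ := by
    rintro _ ⟨w, rfl⟩
    rw [CentralExtension.mem_center_iff]
    exact ⟨hcen w.2, fun h => by simp [hf, hαc, hβc]⟩
  have : D.Normal := ⟨fun n hn g => by
    rw [Subgroup.mem_center_iff.1 (hDcen hn) g, mul_inv_cancel_right]; exact hn⟩
  -- Doubled to avoid the binomial `C(n,2)`; at `n = p` odd it shows that the extension has `p`-th
  -- powers trivial.
  have hpow : ∀ (x : CentralExtension f) (n : ℕ), (x ^ n).base = x.base ^ n ∧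
      2 * (x ^ n).fiber = 2 * n * x.fiber -
        n * (n - 1) * ((α x.base).toAdd * (β x.base).toAdd) := by
    intro x n
    induction n with
    | zero => simp
    | succ n ih =>
      refine ⟨by rw [pow_succ, pow_succ, CentralExtension.mul_base, ih.1], ?_⟩
      rw [pow_succ, CentralExtension.mul_fiber, mul_add, mul_add, ih.2, hf, ih.1, map_pow,
        toAdd_pow, nsmul_eq_mul]
      push_cast
      ring
  obtain ⟨χ, hχD, hχ⟩ := exists_hom_zmod_ne_one (p := p) D
    (fun a b => by
      refine ⟨⟨groupComm a.base b.base, groupComm_mem _ _⟩, ?_⟩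
      ext
      · simp [groupComm]
      · rw [hl]
        simp only [CentralExtension.mul_fiber, CentralExtension.mul_base,
          CentralExtension.inv_fiber, CentralExtension.inv_base, hf, map_mul, map_inv,
          toAdd_mul, toAdd_inv]
        ring)
    (fun a => by
      refine ⟨1, ?_⟩
      obtain ⟨hb, hF⟩ := hpow a p
      ext
      · rw [hb, hexp]; rfl
      · rw [CharP.cast_eq_zero] at hF
        simpa [h2] using hF)
    (g := ⟨1, 1⟩) (by
      rintro ⟨w, hw⟩
      have h₁ := congrArg CentralExtension.base hw
      have h₃ := congrArg CentralExtension.fiber hw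
      have : w = 1 := Subtype.ext h₁.symm
      simp [this] at h₃)
  have hfib : ∀ c : ZMod p, (χ ⟨1, c⟩).toAdd = (χ ⟨1, 1⟩).toAdd * c := by
    let θ : ZMod p →+ ZMod p :=
      { toFun := fun c => (χ ⟨1, c⟩).toAdd
        map_zero' := congrArg Multiplicative.toAdd (map_one χ)
        map_add' := fun c d => by
          rw [← toAdd_mul, ← map_mul]
          congr 2
          ext <;> simp [hf] }
    intro c
    have := (AddMonoidHom.toZModLinearMap p θ).map_smul c 1
    simp only [smul_eq_mul, mul_one] at this
    rw [mul_comm]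
    exact this
  have hsplit : ∀ (g : G) (c : ZMod p),
      (χ ⟨g, c⟩).toAdd = (χ ⟨g, 0⟩).toAdd + (χ ⟨1, 1⟩).toAdd * c := by
    intro g c
    rw [← hfib, ← toAdd_mul, ← map_mul]
    congr 2
    ext <;> simp [hf]
  refine ⟨fun g => (χ ⟨g, 0⟩).toAdd, (χ ⟨1, 1⟩).toAdd, fun h => hχ h, fun g h => ?_,
    fun w => ?_⟩
  · have h₁ : (χ ⟨g, 0⟩).toAdd + (χ ⟨h, 0⟩).toAdd =
        (χ ⟨g * h, -((α g).toAdd * (β h).toAdd)⟩).toAdd := by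
      rw [← toAdd_mul, ← map_mul]
      congr 2
      ext <;> simp [hf]
    rw [hsplit (g * h)] at h₁
    rw [h₁]
    ring
  · have h₁ := congrArg Multiplicative.toAdd (hχD ⟨w, -(l w).toAdd⟩ ⟨w, rfl⟩)
    rw [hsplit, toAdd_one] at h₁
    linear_combination h₁

/-- The `2`-cocycle describing the class-three cover of a Heisenberg quotient. -/
def heisenbergCocycle {p : ℕ} [Fact p.Prime] (hp2 : (2 : ZMod p) ≠ 0)
    (α β : G →* Multiplicative (ZMod p)) (γ : G → ZMod p) (u : ZMod p)
    (hγ : ∀ g h, γ (g * h) = γ g + γ h + u * ((α g).toAdd * (β h).toAdd)) :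
    NormalizedCocycle G (ZMod p) where
  toFun g h := (α g).toAdd * γ h +
    u * ((α g).toAdd * ((α g).toAdd - 1) * 2⁻¹) * (β h).toAdd
  one_left g := by simp
  one_right g := by
    have := hγ 1 1
    simp at this
    simp [this]
  cocycle a b c := by
    simp only [hγ, map_mul, toAdd_mul]
    -- The defect of `γ` contributes `-uα(a)α(b)β(c)`; the cross term of `C(s+t,2) = C(s,2) + C(t,2)
    -- + st` cancels it.
    linear_combination (u * (α a).toAdd * (α b).toAdd * (β c).toAdd) * mul_inv_cancel₀ hp2

/-- The product of two homomorphisms to `ZMod p`, as a `2`-cocycle. -/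
def productCocycle {p : ℕ} (φ ψ : G →* Multiplicative (ZMod p)) :
    NormalizedCocycle G (ZMod p) where
  toFun g h := (φ g).toAdd * (ψ h).toAdd
  one_left g := by simp
  one_right g := by simp
  cocycle a b c := by
    simp only [map_mul, toAdd_mul]
    ring

end ClassTwo

/-! ### Bases, coordinates and the commutator form. -/

theorem addSubgroup_eq_top_of_span_zmod_eq_top {p : ℕ} {V : Type*} [AddCommGroup V]
    [Module (ZMod p) V] {s : Set V} (hs : Submodule.span (ZMod p) s = ⊤) {T : AddSubgroup V}
    (hT : s ⊆ T) : T = ⊤ := by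
  have h : Submodule.span (ZMod p) s ≤ AddSubgroup.toZModSubmodule p T :=
    Submodule.span_le.2 hT
  rw [hs] at h
  exact eq_top_iff.2 fun _ _ => h Submodule.mem_top

/-- A subgroup containing a basis is the whole group. -/
theorem IsElementaryAbelianBasis.eq_top_of_mem {A : Type*} [Group A] {p : ℕ}
    {hc : ∀ a b : A, a * b = b * a} {he : ∀ a : A, a ^ p = 1} {ι : Type*}
    {b : ι → A} (hb : IsElementaryAbelianBasis p hc he b) (T : Subgroup A)
    (hT : ∀ i, b i ∈ T) : T = ⊤ := by
  let _ : CommGroup A := commGroupOfComm hc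
  let _ : Module (ZMod p) (Additive A) := elementaryAbelianModule p A he
  have h : Subgroup.toAddSubgroup T = ⊤ := by
    refine addSubgroup_eq_top_of_span_zmod_eq_top (p := p) hb.2 ?_
    rintro _ ⟨i, rfl⟩
    exact hT i
  exact Subgroup.toAddSubgroup.injective h

/-- Homomorphisms agreeing on the centre and on elements spanning the central quotient agree. -/
theorem hom_ext_of_span {G M : Type*} [Group G] [Group M] {p : ℕ}
    (hc : ∀ a b : G ⧸ Subgroup.center G, a * b = b * a)
    (he : ∀ a : G ⧸ Subgroup.center G, a ^ p = 1) {ι : Type*} (x : ι → G)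
    (hx : IsElementaryAbelianBasis p hc he (fun i => (x i : G ⧸ Subgroup.center G)))
    (f₁ f₂ : G →* M) (hcen : ∀ g ∈ Subgroup.center G, f₁ g = f₂ g)
    (hxi : ∀ i, f₁ (x i) = f₂ (x i)) : f₁ = f₂ := by
  -- The locus of agreement surjects onto `G/Z(G)`, and the remaining central factor is covered by
  -- `hcen`.
  have hT : (f₁.eqLocus f₂).map (QuotientGroup.mk' (Subgroup.center G)) = ⊤ :=
    hx.eq_top_of_mem _ fun i => ⟨x i, hxi i, rfl⟩
  ext g
  have hg : (g : G ⧸ Subgroup.center G) ∈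
      (f₁.eqLocus f₂).map (QuotientGroup.mk' (Subgroup.center G)) := hT ▸ Subgroup.mem_top _
  obtain ⟨s, hs, hsg⟩ := hg
  have hsg' : (s : G ⧸ Subgroup.center G) = (g : G ⧸ Subgroup.center G) := hsg
  have h₁ := hcen _ (QuotientGroup.eq.1 hsg')
  have hs' : f₁ s = f₂ s := hs
  rw [map_mul, map_mul, map_inv, map_inv, hs'] at h₁
  exact mul_left_cancel h₁

/-- The coordinate homomorphisms of a basis. -/
theorem IsElementaryAbelianBasis.exists_coord {A : Type*} [Group A] {p : ℕ}
    {hc : ∀ a b : A, a * b = b * a} {he : ∀ a : A, a ^ p = 1} {ι : Type*} [DecidableEq ι]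
    {b : ι → A} (hb : IsElementaryAbelianBasis p hc he b) :
    ∃ φ : ι → A →* Multiplicative (ZMod p),
      (∀ i j, (φ i (b j)).toAdd = if j = i then 1 else 0) ∧
      ∀ a, (∀ i, φ i a = 1) → a = 1 := by
  let _ : CommGroup A := commGroupOfComm hc
  let _ : Module (ZMod p) (Additive A) := elementaryAbelianModule p A he
  let B := Module.Basis.mk hb.1 hb.2.ge
  refine ⟨fun i => AddMonoidHom.toMultiplicativeRight (B.coord i).toAddMonoidHom,
    fun i j => ?_, fun a ha => ?_⟩
  · have : Additive.ofMul (b j) = B j := by rw [Module.Basis.mk_apply]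
    change B.coord i (Additive.ofMul (b j)) = _
    rw [this, Module.Basis.coord_apply, Module.Basis.repr_self, Finsupp.single_apply]
  · exact (B.forall_coord_eq_zero_iff (x := Additive.ofMul a)).1 ha

/-- The functional on `[G, G]` dual to a commutator `[x j, x i]` pulls back along the commutator
to the alternating form of the corresponding coordinates. -/
theorem commutator_coord_eq {G : Type*} [Group G] {p : ℕ}
    (hcen : commutator G ≤ Subgroup.center G)
    (hc : ∀ a b : G ⧸ Subgroup.center G, a * b = b * a)
    (he : ∀ a : G ⧸ Subgroup.center G, a ^ p = 1) {ι : Type*} (x : ι → G)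
    (hx : IsElementaryAbelianBasis p hc he (fun i => (x i : G ⧸ Subgroup.center G)))
    (α β : G →* Multiplicative (ZMod p)) (l : commutator G →* Multiplicative (ZMod p))
    (hα : ∀ g ∈ Subgroup.center G, α g = 1) (hβ : ∀ g ∈ Subgroup.center G, β g = 1)
    (hl : ∀ i j, (l ⟨groupComm (x i) (x j), groupComm_mem _ _⟩).toAdd =
      (α (x i)).toAdd * (β (x j)).toAdd - (β (x i)).toAdd * (α (x j)).toAdd) (g h : G) :
    (l ⟨groupComm g h, groupComm_mem g h⟩).toAdd =
      (α g).toAdd * (β h).toAdd - (β g).toAdd * (α h).toAdd := by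
  let L (h : G) : G →* Multiplicative (ZMod p) :=
    MonoidHom.mk' (fun g => l ⟨groupComm g h, groupComm_mem g h⟩) fun a b => by
      rw [← map_mul]
      exact congrArg l (Subtype.ext (groupComm_mul_left hcen a b h))
  let R (h : G) : G →* Multiplicative (ZMod p) :=
    MonoidHom.mk' (fun g => .ofAdd
      ((α g).toAdd * (β h).toAdd - (β g).toAdd * (α h).toAdd)) fun a b => by
        rw [← ofAdd_add]
        simp only [map_mul, toAdd_mul]
        congr 1
        ring
  have hLswap : ∀ a b, L a b = (L b a)⁻¹ := fun a b => by
    change l _ = (l _)⁻¹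
    rw [← map_inv]
    exact congrArg l (Subtype.ext (groupComm_inv a b).symm)
  have hRswap : ∀ a b, R a b = (R b a)⁻¹ := fun a b => by
    change Multiplicative.ofAdd _ = (Multiplicative.ofAdd _)⁻¹
    rw [← ofAdd_neg]
    congr 1
    ring
  have hLcen : ∀ b, ∀ a ∈ Subgroup.center G, L b a = R b a := fun b a ha => by
    have h₁ : L b a = l 1 := congrArg l (Subtype.ext (groupComm_eq_one_of_mem_center ha b))
    have h₂ : R b a = 1 := by
      change Multiplicative.ofAdd _ = _
      simp [hα a ha, hβ a ha]
    rw [h₁, h₂, map_one]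
  have hbase : ∀ j, L (x j) = R (x j) := fun j =>
    hom_ext_of_span hc he x hx _ _ (hLcen _) fun i => hl i j
  -- Antisymmetry turns the case of a basis element in the second slot into one in the first.
  have hall : L h = R h := hom_ext_of_span hc he x hx _ _ (hLcen _) fun i => by
    rw [hLswap, hRswap, hbase]
  exact congrArg Multiplicative.toAdd (DFunLike.congr_fun hall g)

/-! ### The capability theorem. -/

theorem mainTheorem10 {G : Type*} [Group G] [Group.FG G] [Group.IsNilpotent G]
    (hclass : Group.nilpotencyClass G = 2)
    {p : ℕ} (hp : p.Prime) (hexp : Monoid.exponent G = p)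
    {k : ℕ} (x : Fin k → G)
    (hx : IsElementaryAbelianBasis p (centralQuotient_mul_comm hclass) (centralQuotient_pow hexp)
      (fun i => (x i : G ⧸ Subgroup.center G)))
    (hcomm : IsElementaryAbelianBasis p (commutator_mul_comm hclass) (commutator_pow hexp)
      (fun q : {q : Fin k × Fin k // q.1 < q.2 ∧ groupComm (x q.2) (x q.1) ≠ 1} =>
        (⟨groupComm (x q.1.2) (x q.1.1), groupComm_mem _ _⟩ : commutator G))) :
    IsCapable G := by
  classical
  have : Fact p.Prime := ⟨hp⟩
  have hpow : ∀ g : G, g ^ p = 1 := fun g => hexp ▸ Monoid.pow_exponent_eq_one g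
  have hcen := commutator_le_center_of_class_two hclass
  have hnt : ∃ y : G, y ∉ Subgroup.center G := by
    by_contra! hall
    have h₁ : Group.nilpotencyClass G ≤ 1 := by
      let _ : CommGroup G := commGroupOfComm fun a b =>
        (Subgroup.mem_center_iff.1 (hall b) a)
      exact CommGroup.nilpotencyClass_le_one
    omega
  have hp2 : p ≠ 2 := by
    rintro rfl
    obtain ⟨y, hy⟩ := hnt
    refine hy (Subgroup.mem_center_iff.2 fun z => ?_)
    exact mul_comm_of_exponent_two hexp z y
  have h2 : (2 : ZMod p) ≠ 0 := by
    intro h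
    have h' : ((2 : ℕ) : ZMod p) = 0 := by exact_mod_cast h
    rw [ZMod.natCast_eq_zero_iff] at h'
    exact hp2 ((Nat.prime_dvd_prime_iff_eq hp Nat.prime_two).1 h')
  refine isCapable_of_cocycles (A := ZMod p) fun g hg hg1 => ?_
  by_cases hgW : g ∈ commutator G
  · obtain ⟨φ, hφ, -⟩ := hx.exists_coord
    obtain ⟨l, hl, hsep⟩ := hcomm.exists_coord
    obtain ⟨⟨⟨i, j⟩, hij, hne⟩, he⟩ : ∃ e, l e ⟨g, hgW⟩ ≠ 1 := by
      by_contra! h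
      exact hg1 (congrArg Subtype.val (hsep _ h))
    let co (m : Fin k) : G →* Multiplicative (ZMod p) := (φ m).comp (QuotientGroup.mk' _)
    have hco : ∀ m, ∀ z ∈ Subgroup.center G, co m z = 1 := fun m z hz => by
      rw [MonoidHom.comp_apply, QuotientGroup.mk'_apply, (QuotientGroup.eq_one_iff z).2 hz,
        map_one]
    have hcox : ∀ m n, (co m (x n)).toAdd = if n = m then 1 else 0 := hφ
    set e : {q : Fin k × Fin k // q.1 < q.2 ∧ groupComm (x q.2) (x q.1) ≠ 1} :=
      ⟨⟨i, j⟩, hij, hne⟩ with he_def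
    have hlt : ∀ m n, m < n → (l e ⟨groupComm (x n) (x m), groupComm_mem _ _⟩).toAdd =
        (co j (x n)).toAdd * (co i (x m)).toAdd - (co i (x n)).toAdd * (co j (x m)).toAdd := by
      intro m n hmn
      have hswap : ¬(n = i ∧ m = j) := by
        rintro ⟨rfl, rfl⟩
        exact lt_asymm hij hmn
      have hR : (co j (x n)).toAdd * (co i (x m)).toAdd -
          (co i (x n)).toAdd * (co j (x m)).toAdd = if m = i ∧ n = j then 1 else 0 := by
        have h0 : (co i (x n)).toAdd * (co j (x m)).toAdd = 0 := by
          rw [hcox, hcox, ite_zero_mul_ite_zero, if_neg hswap]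
        rw [h0, sub_zero, hcox, hcox, ite_zero_mul_ite_zero, mul_one]
        exact if_congr and_comm rfl rfl
      rw [hR]
      by_cases h1 : groupComm (x n) (x m) = 1
      · have hno : ¬(m = i ∧ n = j) := by
          rintro ⟨rfl, rfl⟩
          exact hne h1
        rw [if_neg hno]
        have : (⟨groupComm (x n) (x m), groupComm_mem _ _⟩ : commutator G) = 1 :=
          Subtype.ext h1
        rw [this, map_one, toAdd_one]
      · have := hl e ⟨⟨m, n⟩, hmn, h1⟩
        simpa [he_def] using this
    have hform := commutator_coord_eq hcen _ _ x hx (co j) (co i) (l e) (hco j) (hco i)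
      (fun n m => by
        rcases lt_trichotomy m n with h | rfl | h
        · exact hlt m n h
        · have : (⟨groupComm (x m) (x m), groupComm_mem _ _⟩ : commutator G) = 1 :=
            Subtype.ext (by simp [groupComm])
          rw [this, map_one, toAdd_one]
          ring
        · have : (⟨groupComm (x n) (x m), groupComm_mem _ _⟩ : commutator G) =
              (⟨groupComm (x m) (x n), groupComm_mem _ _⟩)⁻¹ :=
            Subtype.ext (groupComm_inv _ _).symm
          rw [this, map_inv, toAdd_inv, hlt n m h]
          ring)
    obtain ⟨γ, u, hu, hγ, hγW⟩ :=
      exists_quasi_hom hp2 hpow hcen (co j) (co i) (l e) (hco j) (hco i) hform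
    -- Here `α(g) = β(g) = 0` and `α(x_j) = 1`, so `f(g,x_j) = 0` while `f(x_j,g) = γ(g)`.
    refine ⟨heisenbergCocycle h2 (co j) (co i) γ u hγ, x j, ?_⟩
    have hγg : γ g ≠ 0 := by
      rw [hγW ⟨g, hgW⟩]
      exact mul_ne_zero hu fun h => he h
    simpa [heisenbergCocycle, hco _ g hg, hcox] using hγg.symm
  · obtain ⟨y, hy⟩ := hnt
    obtain ⟨φ, -, hφ⟩ := exists_hom_zmod_ne_one (p := p) (commutator G)
      groupComm_mem (fun a => by rw [hpow]; exact one_mem _) hgW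
    obtain ⟨ψ, hψ, hψy⟩ := exists_hom_zmod_ne_one (p := p) (Subgroup.center G)
      (fun a b => hcen (groupComm_mem a b)) (fun a => by rw [hpow]; exact one_mem _) hy
    -- `ψ(g) = 0` because `g` is central, so only `f(g,y) = φ(g)ψ(y)` survives.
    refine ⟨productCocycle φ ψ, y, ?_⟩
    have h₁ : (φ g).toAdd ≠ 0 := fun h => hφ h
    have h₂ : (ψ y).toAdd ≠ 0 := fun h => hψy h
    simpa [productCocycle, hψ g hg] using And.intro hφ hψy
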